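/- Let $d\ge 1$ and let $K$ be a field of characteristic zero. Let $k\ge 1$, let $\mathbf p=(p_1,\dots,p_k)$ be a vector of polynomials in $\mathbb Z[i,j_1,\dots,j_{d-1},n]$ of total degree at most one, and let $\mathbf m=(m_1,\dots,m_k)$ be a vector of positive integers. For every $\mathbf r\in\prod_{q=1}^k\{0,\dots,m_q-1\}$ let $\mathbf S_{\mathbf r}$ be a finite subset of $\mathbb Z^d$ and let $w_{\mathbf r}\colon \mathbf S_{\mathbf r}\to K$ be a weight function. Fix a starting point $(i_0,\mathbf j_0)\in\mathbb Z_{\ge0}\times\mathbb Z^{d-1}$. Consider walks in the half-space $\mathbb Z_{\ge0}\times\mathbb Z^{d-1}$ that start at $(i_0,\mathbf j_0)$, never leave the half-space, and satisfy the following restriction: whenever the position of the walk after $n$ steps is $(i,\mathbf j)$, the $(n+1)$st step must be taken from $\mathbf S_{\mathbf r}$ with $\mathbf r=\mathbf p(i,\mathbf j,n)\bmod\mathbf m$ (componentwise), and it then has weight $w_{\mathbf r}(u,\mathbf v)$, where $(u,\mathbf v)$ is the step. The weight of a walk is the product of the weights of its steps. Let $f_{i,\mathbf j,n}\in K$ be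 the sum of the weights of all such walks of length $n$ from $(i_0,\mathbf j_0)$ to $(i,\mathbf j)$. Then the generating function $$F(x,\mathbf y,t)=\sum_{i,\mathbf j,n} f_{i,\mathbf j,n}\,x^i\mathbf y^{\mathbf j}t^n\in K[x,\mathbf y,\mathbf y^{-1}][[t]],\qquad \mathbf y=(y_1,\dots,y_{d-1}),$$ is algebraic over $K[x,\mathbf y,t]$. -/

import Mathlib

open scoped PowerSeries

/-- The variables of the polynomial ring `ℤ[i, j₁, …, j_e, n]` (with `e = d - 1`). -/
inductive WalkVar (e : ℕ) : Type
  | i : WalkVar e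
  | j (l : Fin e) : WalkVar e
  | n : WalkVar e

/-- A weighted model of inhomogeneous lattice walks in the half-space `ℤ_{≥0} × ℤ^{d-1}`,
where `e = d - 1`, with weights in `K`. The index set `{0, …, m_1 - 1} × ⋯ × {0, …, m_k - 1}`
is represented by `∀ q, ZMod (m q)`. -/
structure HalfSpaceModel (K : Type*) (e : ℕ) where
  /-- the number of polynomials -/
  k : ℕ
  /-- the moduli -/
  m : Fin k → ℕ
  m_pos : ∀ q, 0 < m q
  /-- the polynomials that select the step set -/
  p : Fin k → MvPolynomial (WalkVar e) ℤ
  p_degree : ∀ q, (p q).totalDegree ≤ 1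
  /-- the finite step sets `S_r ⊆ ℤ^d` -/
  S : (∀ q, ZMod (m q)) → Finset (ℤ × (Fin e → ℤ))
  /-- the weights; only the values of `w r` on `S r` are ever used -/
  w : (∀ q, ZMod (m q)) → ℤ × (Fin e → ℤ) → K
  /-- the starting point `(i₀, j₀)` in the half-space -/
  start : ℕ × (Fin e → ℤ)

namespace HalfSpaceModel

variable {K : Type*} {e : ℕ}

instance (M : HalfSpaceModel K e) (q : Fin M.k) : NeZero (M.m q) := ⟨(M.m_pos q).ne'⟩

/-- The vector `p(i, j, n) mod m`. -/
noncomputable def residue (M : HalfSpaceModel K e) (P : ℤ × (Fin e → ℤ)) (n : ℕ) :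
    ∀ q, ZMod (M.m q) := fun q =>
  ((MvPolynomial.eval
    (fun v : WalkVar e => match v with
      | .i => P.1
      | .j l => P.2 l
      | .n => (n : ℤ)) (M.p q) : ℤ) : ZMod (M.m q))

/-- The position after the first `l` steps of the step sequence `s`. -/
def pos (M : HalfSpaceModel K e) {n : ℕ} (s : Fin n → ℤ × (Fin e → ℤ)) (l : ℕ) :
    ℤ × (Fin e → ℤ) :=
  ((M.start.1 : ℤ), M.start.2) + ∑ a ∈ Finset.univ.filter (fun a : Fin n => (a : ℕ) < l), s a

/-- The step sequence `s` is a walk of the model: it never leaves the half-space, and each step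
is taken from the step set selected by the current position and the number of steps so far. -/
def IsWalk (M : HalfSpaceModel K e) {n : ℕ} (s : Fin n → ℤ × (Fin e → ℤ)) : Prop :=
  (∀ l ≤ n, 0 ≤ (M.pos s l).1) ∧ ∀ a : Fin n, s a ∈ M.S (M.residue (M.pos s a) a)

open Classical in
/-- The finite set of all walks of length `n` of the model. -/
noncomputable def walks (M : HalfSpaceModel K e) (n : ℕ) : Finset (Fin n → ℤ × (Fin e → ℤ)) :=
  (Fintype.piFinset fun _ => Finset.univ.biUnion M.S).filter M.IsWalk

theorem mem_walks (M : HalfSpaceModel K e) {n : ℕ} (s : Fin n → ℤ × (Fin e → ℤ)) :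
    s ∈ M.walks n ↔ M.IsWalk s := by
  simp only [walks, Finset.mem_filter, Fintype.mem_piFinset, Finset.mem_biUnion,
    Finset.mem_univ, true_and, and_iff_right_iff_imp]
  exact fun h a => ⟨_, h.2 a⟩

variable [Field K]

/-- The weight of a walk: the product of the weights of its steps. -/
noncomputable def weight (M : HalfSpaceModel K e) {n : ℕ} (s : Fin n → ℤ × (Fin e → ℤ)) : K :=
  ∏ a : Fin n, M.w (M.residue (M.pos s a) a) (s a)

/-- The coefficient `f_{i, j, n}`: the sum of the weights of all walks of length `n` from the
starting point to `(i, j)`. -/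
noncomputable def f (M : HalfSpaceModel K e) (i : ℕ) (j : Fin e → ℤ) (n : ℕ) : K :=
  ∑ s ∈ M.walks n with M.pos s n = ((i : ℤ), j), M.weight s

end HalfSpaceModel

/-- The ring `K[x, y, y⁻¹]`, where `y = (y₁, …, y_e)`: the monomial `x ^ i * y ^ j` is
`AddMonoidAlgebra.single (i, j) 1`. -/
abbrev HalfLaurent (K : Type*) [Field K] (e : ℕ) : Type _ :=
  AddMonoidAlgebra K (ℕ × (Fin e → ℤ))

/-- The polynomial ring `K[x, y, t]` as a subalgebra of `K[x, y, y⁻¹][[t]]`. -/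
noncomputable def polyXYT (K : Type*) [Field K] (e : ℕ) :
    Subalgebra K (HalfLaurent K e)⟦X⟧ :=
  Algebra.adjoin K
    ({PowerSeries.C (AddMonoidAlgebra.single ((1 : ℕ), (0 : Fin e → ℤ)) (1 : K)),
        (PowerSeries.X : (HalfLaurent K e)⟦X⟧)} ∪
      Set.range fun l : Fin e =>
        PowerSeries.C (AddMonoidAlgebra.single ((0 : ℕ), (Pi.single l 1 : Fin e → ℤ)) (1 : K)))

namespace HalfSpaceModel

variable {K : Type*} [Field K] {e : ℕ}

open Classical in
/-- The endpoints of the walks of length `n`, as points of `ℤ_{≥0} × ℤ^{d-1}`. -/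
noncomputable def endpoints (M : HalfSpaceModel K e) (n : ℕ) : Finset (ℕ × (Fin e → ℤ)) :=
  (M.walks n).image fun s => ((M.pos s n).1.toNat, (M.pos s n).2)

/-- The generating function `F(x, y, t) = ∑ f_{i, j, n} x^i y^j t^n` in `K[x, y, y⁻¹][[t]]`. -/
noncomputable def F (M : HalfSpaceModel K e) : (HalfLaurent K e)⟦X⟧ :=
  PowerSeries.mk fun n =>
    ∑ P ∈ M.endpoints n, AddMonoidAlgebra.single P (M.f P.1 P.2 n)

theorem coeff_F (M : HalfSpaceModel K e) (i : ℕ) (j : Fin e → ℤ) (n : ℕ) :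
    (PowerSeries.coeff n M.F).coeff (i, j) = M.f i j n := by
  classical
  have key : (PowerSeries.coeff n M.F).coeff (i, j) =
      ∑ P ∈ M.endpoints n, if P = (i, j) then M.f P.1 P.2 n else 0 := by
    simp [F, Finsupp.single_apply, Finsupp.finsetSum_apply]
  rw [key, Finset.sum_ite_eq']
  split_ifs with h
  · rfl
  · symm
    unfold f
    rw [Finset.filter_eq_empty_iff.2, Finset.sum_empty]
    intro s hs hpos
    exact h (Finset.mem_image.2 ⟨s, hs, by simp [hpos]⟩)

end HalfSpaceModel

open scoped PowerSeries

/-! Choose a common multiple `N` of the moduli that bounds the horizontal size of every step, and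
cut the half-space into slabs (levels) of width `N`. The rule for the next step depends only on a
finite state, the residues mod `N` of position and time, and each step changes the level by at most
one. The walk is thus a finite-state process on levels `0, 1, 2, …`, and first-passage decomposition
reduces its generating functions to finitely many polynomial equations `z = c + t P(z)`
(`exists_level_recursion`).

Such a system has a power series solution by `t`-adic iteration. Its Jacobian `1 - t P'(z)` is
invertible at `t = 0`, so the Jacobian criterion (`isAlgebraic_of_jacobian`) makes the solution
algebraic. Working inside the algebraic closure of `K[x, y, t]` in the power series ring lets one
system supply coefficients for the next. Finally, the first-step recursion determines its solution
`t`-adically, which identifies `F` up to the monomial of the starting point (`F_eq_of_firstStep`).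
-/

/-! ### The Jacobian criterion for algebraicity -/

theorem Derivation.map_mvPolynomial_aeval {k A N ι : Type*} [CommRing k] [CommRing A] [Algebra k A]
    [AddCommGroup N] [Module A N] [Module k N] [IsScalarTower k A N] [Fintype ι]
    (D : Derivation k A N) (z : ι → A) (p : MvPolynomial ι k) :
    D (MvPolynomial.aeval z p) = ∑ j, MvPolynomial.aeval z (MvPolynomial.pderiv j p) • D (z j) := by
  classical
  induction p using MvPolynomial.induction_on with
  | C a => simp
  | add p q hp hq => simp [hp, hq, add_smul, Finset.sum_add_distrib]
  | mul_X p i hp =>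
    simp only [map_mul, MvPolynomial.aeval_X, Derivation.leibniz, hp, MvPolynomial.pderiv_X,
      smul_eq_mul, map_add, add_smul, Finset.sum_add_distrib, Finset.smul_sum, smul_smul]
    congr 1
    · rw [Finset.sum_eq_single i] <;> simp +contextual [eq_comm]

theorem smul_eq_zero_of_det_ne_zero {F N ι : Type*} [Field F] [AddCommGroup N] [Module F N]
    [Fintype ι] [DecidableEq ι] (J : Matrix ι ι F) (hJ : J.det ≠ 0) (v : ι → N)
    (h : ∀ i, ∑ j, J i j • v j = 0) (l : ι) : v l = 0 := by
  have h1 : ∑ i, J.adjugate l i • ∑ j, J i j • v j = J.det • v l := by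
    simp only [Finset.smul_sum, smul_smul]
    rw [Finset.sum_comm]
    simp only [← Finset.sum_smul, ← Matrix.mul_apply, Matrix.adjugate_mul, Matrix.smul_apply,
      Matrix.one_apply, smul_eq_mul, mul_ite, mul_one, mul_zero, ite_smul, zero_smul]
    simp
  simp only [h, smul_zero, Finset.sum_const_zero] at h1
  exact (smul_eq_zero.1 h1.symm).resolve_left hJ

/-- Differentiating the equations gives a linear system for the differentials `D (z j)` with
invertible matrix, so they all vanish. Hence `k(z)` has no Kähler differentials over `k`; being
finitely generated and unramified, it is separable algebraic. -/
theorem isAlgebraic_of_jacobian_field {k L ι : Type*} [Field k] [Field L] [Algebra k L] [Fintype ι]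
    [DecidableEq ι] (z : ι → L) (P : ι → MvPolynomial ι k)
    (hP : ∀ i, MvPolynomial.aeval z (P i) = 0)
    (hJ : (Matrix.of fun i j => MvPolynomial.aeval z (MvPolynomial.pderiv j (P i))).det ≠ 0)
    (i : ι) : IsAlgebraic k (z i) := by
  set F := IntermediateField.adjoin k (Set.range z) with hF
  let y : ι → F := fun i => ⟨z i, IntermediateField.subset_adjoin k _ ⟨i, rfl⟩⟩
  have hy (p : MvPolynomial ι k) :
      algebraMap F L (MvPolynomial.aeval y p) = MvPolynomial.aeval z p :=
    (MvPolynomial.aeval_algebraMap_apply L y p).symm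
  have hy0 (i) : MvPolynomial.aeval y (P i) = 0 :=
    (algebraMap F L).injective (by rw [hy, hP, map_zero])
  let J : Matrix ι ι F :=
    Matrix.of fun i j => MvPolynomial.aeval y (MvPolynomial.pderiv j (P i))
  have hJF : J.det ≠ 0 := by
    intro h
    apply hJ
    have h2 := congrArg (algebraMap F L) h
    rw [RingHom.map_det, map_zero] at h2
    rw [← h2]
    congr 1
    ext a b
    exact (hy _).symm
  have hD (j) : KaehlerDifferential.D k F (y j) = 0 := by
    refine smul_eq_zero_of_det_ne_zero J hJF (fun j => KaehlerDifferential.D k F (y j)) ?_ j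
    intro a
    have := Derivation.map_mvPolynomial_aeval (KaehlerDifferential.D k F) y (P a)
    rw [hy0, map_zero] at this
    exact this.symm
  have hD' (x : L) (hx : x ∈ F) : KaehlerDifferential.D k F ⟨x, hx⟩ = 0 := by
    induction hx using IntermediateField.adjoin_induction with
    | mem x hx =>
      obtain ⟨j, rfl⟩ := hx
      exact hD j
    | algebraMap x => exact (KaehlerDifferential.D k F).map_algebraMap x
    | add x y hx hy h1 h2 =>
      have := (KaehlerDifferential.D k F).map_add ⟨x, hx⟩ ⟨y, hy⟩
      rw [h1, h2, add_zero] at this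
      exact this
    | inv x hx h =>
      have := (KaehlerDifferential.D k F).leibniz_inv ⟨x, hx⟩
      rw [h, smul_zero] at this
      exact this
    | mul x y hx hy h1 h2 =>
      have := (KaehlerDifferential.D k F).leibniz ⟨x, hx⟩ ⟨y, hy⟩
      rw [h1, h2, smul_zero, smul_zero, add_zero] at this
      exact this
  have hun : Algebra.FormallyUnramified k F := by
    refine ⟨?_⟩
    have h := KaehlerDifferential.span_range_derivation k F
    have h0 : Set.range (KaehlerDifferential.D k F) ⊆ {0} := by
      rintro _ ⟨x, rfl⟩
      exact hD' x.1 x.2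
    have h1 : (⊤ : Submodule F (Ω[F⁄k])) ≤ ⊥ := by
      rw [← h, Submodule.span_le]
      exact h0
    exact (Submodule.subsingleton_iff F).1 (subsingleton_of_bot_eq_top (bot_unique h1).symm)
  have hess : Algebra.EssFiniteType k F :=
    IntermediateField.essFiniteType_iff.2 ⟨(Set.finite_range z).toFinset, by simp [hF]⟩
  have hsep := Algebra.FormallyUnramified.isSeparable k F
  have : IsAlgebraic k (y i) := (hsep.isSeparable k (y i)).isIntegral.isAlgebraic
  exact (isAlgebraic_algebraMap_iff (algebraMap F L).injective).2 this

theorem isAlgebraic_of_jacobian {D L ι : Type*} [CommRing D] [IsDomain D] [Field L] [Algebra D L]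
    [FaithfulSMul D L] [Fintype ι] [DecidableEq ι] (z : ι → L) (P : ι → MvPolynomial ι D)
    (hP : ∀ i, MvPolynomial.aeval z (P i) = 0)
    (hJ : (Matrix.of fun i j => MvPolynomial.aeval z (MvPolynomial.pderiv j (P i))).det ≠ 0)
    (i : ι) : IsAlgebraic D (z i) := by
  let := FractionRing.liftAlgebra D L
  have : IsScalarTower D (FractionRing D) L := inferInstance
  rw [IsFractionRing.isAlgebraic_iff D (FractionRing D)]
  refine isAlgebraic_of_jacobian_field z
    (fun i => MvPolynomial.map (algebraMap D (FractionRing D)) (P i)) (fun i => ?_) ?_ i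
  · rw [MvPolynomial.aeval_map_algebraMap, hP]
  · simpa only [MvPolynomial.pderiv_map, MvPolynomial.aeval_map_algebraMap] using hJ

/-! ### Polynomial systems `z = c + t P(z)` -/

/-- A polynomial system `z = c + t P(z)` has a solution in power series. -/
theorem exists_powerSeries_solution {R ι : Type*} [CommRing R] (c : ι → R⟦X⟧)
    (P : ι → MvPolynomial ι R⟦X⟧) :
    ∃ z : ι → R⟦X⟧, ∀ i, z i = c i + PowerSeries.X * MvPolynomial.aeval z (P i) := by
  let T : (ι → R⟦X⟧) → ι → R⟦X⟧ := fun z i => c i + PowerSeries.X * MvPolynomial.aeval z (P i)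
  -- `T` is an `X`-adic contraction: polynomials preserve congruence mod `X ^ n`, and the factor `X`
  -- gains one order.
  have hT (n : ℕ) (z y : ι → R⟦X⟧) (h : ∀ i, (PowerSeries.X : R⟦X⟧) ^ n ∣ z i - y i) (i : ι) :
      (PowerSeries.X : R⟦X⟧) ^ (n + 1) ∣ T z i - T y i := by
    have h2 (p : MvPolynomial ι R⟦X⟧) : (PowerSeries.X : R⟦X⟧) ^ n ∣
        MvPolynomial.aeval z p - MvPolynomial.aeval y p := by
      simp only [← Ideal.mem_span_singleton, ← Ideal.Quotient.eq, MvPolynomial.map_aeval] at h ⊢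
      simp only [h]
    have h1 : T z i - T y i =
        PowerSeries.X * (MvPolynomial.aeval z (P i) - MvPolynomial.aeval y (P i)) := by
      simp only [T]; ring
    rw [h1, pow_succ']
    exact mul_dvd_mul_left _ (h2 _)
  let s : ℕ → ι → R⟦X⟧ := fun n => T^[n] 0
  have hs (n : ℕ) : s (n + 1) = T (s n) := Function.iterate_succ_apply' T n 0
  have hstep (n : ℕ) (i : ι) : (PowerSeries.X : R⟦X⟧) ^ n ∣ s (n + 1) i - s n i := by
    induction n generalizing i with
    | zero => simp
    | succ n ih => rw [hs (n + 1), hs n]; rw [hs n] at ih; exact hT n _ _ ih i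
  have hmono (n k : ℕ) (i : ι) : (PowerSeries.X : R⟦X⟧) ^ n ∣ s (n + k) i - s n i := by
    induction k with
    | zero => simp
    | succ k ih =>
      have := dvd_add ((pow_dvd_pow PowerSeries.X (Nat.le_add_right n k)).trans (hstep (n + k) i)) ih
      simpa [← add_assoc] using this
  -- Coefficient `n` is constant from the iterate `n + 1` on, so this is the limit.
  let z : ι → R⟦X⟧ := fun i => PowerSeries.mk fun n => PowerSeries.coeff n (s (n + 1) i)
  have hz (n : ℕ) (i : ι) : (PowerSeries.X : R⟦X⟧) ^ n ∣ z i - s n i := by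
    rw [PowerSeries.X_pow_dvd_iff]
    intro m hm
    obtain ⟨k, rfl⟩ := Nat.exists_eq_add_of_lt hm
    have := (PowerSeries.X_pow_dvd_iff.1 (hmono (m + 1) k i)) m (Nat.lt_succ_self m)
    rw [map_sub, sub_eq_zero] at this ⊢
    rw [show m + k + 1 = m + 1 + k by ring, this]
    simp [z]
  refine ⟨z, fun i => ?_⟩
  have key (n : ℕ) : (PowerSeries.X : R⟦X⟧) ^ n ∣ z i - T z i := by
    have h1 := hT n _ _ (hz n) i
    rw [← hs] at h1
    have h2 := dvd_sub (hz (n + 1) i) h1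
    rw [sub_sub_sub_cancel_right] at h2
    exact (pow_dvd_pow _ (Nat.le_succ n)).trans h2
  rw [← sub_eq_zero]
  ext n
  exact (PowerSeries.X_pow_dvd_iff.1 (key (n + 1))) n (Nat.lt_succ_self n)

/-- The Jacobian matrix of `z - c - X P(z)` is `1 - X N`, whose determinant has constant coefficient
`1` and is therefore nonzero. -/
theorem isAlgebraic_of_powerSeries_solution {D R ι : Type*} [CommRing D] [IsDomain D] [CommRing R]
    [IsDomain R] [Algebra D R⟦X⟧] [Fintype ι] (hinj' : Function.Injective (algebraMap D R⟦X⟧))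
    (τ : D) (hτ : algebraMap D R⟦X⟧ τ = PowerSeries.X) (c : ι → D) (P : ι → MvPolynomial ι D)
    (z : ι → R⟦X⟧)
    (hz : ∀ i, z i = algebraMap D R⟦X⟧ (c i) + PowerSeries.X * MvPolynomial.aeval z (P i))
    (i : ι) : IsAlgebraic D (z i) := by
  classical
  have hinj : Function.Injective (algebraMap R⟦X⟧ (FractionRing R⟦X⟧)) :=
    IsFractionRing.injective _ _
  have hfaith : FaithfulSMul D (FractionRing R⟦X⟧) := by
    rw [faithfulSMul_iff_algebraMap_injective, IsScalarTower.algebraMap_eq D R⟦X⟧]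
    exact hinj.comp hinj'
  rw [← isAlgebraic_algebraMap_iff hinj]
  let Q : ι → MvPolynomial ι D :=
    fun i => MvPolynomial.X i - MvPolynomial.C (c i) - MvPolynomial.C τ * P i
  have haeval (p : MvPolynomial ι D) :
      MvPolynomial.aeval (fun i => algebraMap R⟦X⟧ (FractionRing R⟦X⟧) (z i)) p =
        algebraMap R⟦X⟧ (FractionRing R⟦X⟧) (MvPolynomial.aeval z p) :=
    MvPolynomial.aeval_algebraMap_apply (FractionRing R⟦X⟧) z p
  refine isAlgebraic_of_jacobian (fun i => algebraMap R⟦X⟧ (FractionRing R⟦X⟧) (z i)) Q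
    (fun i => ?_) ?_ i
  · have : MvPolynomial.aeval z (Q i) = 0 := by
      simp only [Q, map_sub, map_mul, MvPolynomial.aeval_X, MvPolynomial.aeval_C, hτ]
      linear_combination hz i
    rw [haeval, this, map_zero]
  · let N : Matrix ι ι R⟦X⟧ :=
      Matrix.of fun i j => MvPolynomial.aeval z (MvPolynomial.pderiv j (P i))
    have h1 : (1 - (PowerSeries.X : R⟦X⟧) • N).det ≠ 0 := by
      intro h
      have h2 := congrArg (PowerSeries.constantCoeff (R := R)) h
      rw [RingHom.map_det, map_zero] at h2
      have h3 : (PowerSeries.constantCoeff (R := R)).mapMatrix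
          (1 - (PowerSeries.X : R⟦X⟧) • N) = 1 := by
        ext a b
        simp [Matrix.one_apply, apply_ite]
      rw [h3, Matrix.det_one] at h2
      exact one_ne_zero h2
    have h4 : (Matrix.of fun i j => MvPolynomial.aeval z (MvPolynomial.pderiv j (Q i))) =
        1 - (PowerSeries.X : R⟦X⟧) • N := by
      ext1 a b
      have h5 : MvPolynomial.pderiv b (Q a) = (if a = b then 1 else 0) -
          MvPolynomial.C τ * MvPolynomial.pderiv b (P a) := by
        simp [Q, Pi.single_apply]
      simp only [Matrix.of_apply, h5, map_sub, map_mul, MvPolynomial.aeval_C, hτ]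
      simp [N, Matrix.one_apply, apply_ite]
    rw [← h4] at h1
    rw [← map_ne_zero_iff _ hinj, RingHom.map_det] at h1
    simp only [haeval]
    exact h1

/-- A solution is algebraic over `A`, hence over `B` by transitivity, so it lies in `A` again. -/
theorem exists_algebraic_solution {B R ι : Type*} [CommRing B] [IsDomain B] [CommRing R]
    [IsDomain R] [Algebra B R⟦X⟧] [Fintype ι]
    (A : Subalgebra B R⟦X⟧) (hA : ∀ a, a ∈ A ↔ IsAlgebraic B a) (τ : A)
    (hτ : (τ : R⟦X⟧) = PowerSeries.X) (c : ι → A) (P : ι → MvPolynomial ι A) :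
    ∃ z : ι → A, ∀ i, z i = c i + τ * MvPolynomial.aeval z (P i) := by
  obtain ⟨z, hz⟩ := exists_powerSeries_solution (fun i => (c i : R⟦X⟧))
    (fun i => MvPolynomial.map (algebraMap A R⟦X⟧) (P i))
  simp only [MvPolynomial.aeval_map_algebraMap] at hz
  have hinj : Function.Injective (algebraMap A R⟦X⟧) := Subtype.val_injective
  have hBA : Algebra.IsAlgebraic B A := ⟨fun a => (isAlgebraic_algebraMap_iff hinj).1 ((hA _).1 a.2)⟩
  have hmem (i : ι) : z i ∈ A :=
    (hA _).2 ((isAlgebraic_of_powerSeries_solution hinj τ hτ c P z hz i).restrictScalars B)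
  refine ⟨fun i => ⟨z i, hmem i⟩, fun i => hinj ?_⟩
  have := MvPolynomial.aeval_algebraMap_apply R⟦X⟧ (fun i => (⟨z i, hmem i⟩ : A)) (P i)
  rw [map_add, map_mul, ← this, show algebraMap A R⟦X⟧ τ = PowerSeries.X from hτ]
  exact hz i

/-! ### First-passage decomposition by levels -/

/-- The first-passage equations of a walk on levels `0, 1, 2, …` with finitely many states per
level and level changes `-1, 0, 1` can be solved in every ring in which polynomial systems
`z = c + τ P(z)` can be solved. Level `q` has index `q + 1`, and index `0` is the forbidden
level. -/
theorem exists_level_recursion {A : Type*} {σ : Type} [CommRing A] [Fintype σ] [DecidableEq σ]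
    (τ : A) (hsol : ∀ (ι : Type) [Fintype ι] (c : ι → A) (P : ι → MvPolynomial ι A),
      ∃ z : ι → A, ∀ i, z i = c i + τ * MvPolynomial.aeval z (P i))
    (D Z U : Matrix σ σ A) (b : σ → A) (x : A) :
    ∃ H : ℕ → σ → A, H 0 = 0 ∧ ∀ q, H (q + 1) = x ^ q • b +
      τ • (D.mulVec (H q) + Z.mulVec (H (q + 1)) + U.mulVec (H (q + 2))) := by
  -- `G` counts first passages to the level just below: the first step goes down, stays, or goes up
  -- and leaves two levels to descend.
  obtain ⟨G, hG⟩ : ∃ G : Matrix σ σ A, G = τ • (D + Z * G + U * G * G) := by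
    let W : Matrix σ σ (MvPolynomial (σ × σ) A) := Matrix.of fun a b => MvPolynomial.X (a, b)
    let Q : Matrix σ σ (MvPolynomial (σ × σ) A) :=
      D.map MvPolynomial.C + Z.map MvPolynomial.C * W + U.map MvPolynomial.C * W * W
    obtain ⟨z, hz⟩ := hsol (σ × σ) 0 fun ab => Q ab.1 ab.2
    refine ⟨Matrix.of fun a b => z (a, b), ?_⟩
    have hC (T : Matrix σ σ A) : (MvPolynomial.aeval z).toRingHom.mapMatrix
        (T.map (MvPolynomial.C (σ := σ × σ))) = T := by
      ext a b; simp
    have hW : (MvPolynomial.aeval z).toRingHom.mapMatrix W = Matrix.of fun a b => z (a, b) := by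
      ext a b; simp [W]
    have key : (MvPolynomial.aeval z).toRingHom.mapMatrix Q =
        D + Z * (Matrix.of fun a b => z (a, b)) +
          U * (Matrix.of fun a b => z (a, b)) * Matrix.of fun a b => z (a, b) := by
      simp only [Q, map_add, map_mul, hC, hW]
    rw [← key]
    ext a b
    simpa using hz (a, b)
  -- `E` counts walks from level `0` that never go below it. After an up-step, the walk either stays
  -- above forever (`x • E`) or returns once by a first passage (`G E`). With `G` known this system
  -- is linear.
  obtain ⟨E, hE⟩ : ∃ E : σ → A, E = b + τ • (Z.mulVec E + U.mulVec (x • E + G.mulVec E)) := by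
    let V : Matrix σ σ A := Z + x • U + U * G
    obtain ⟨z, hz⟩ := hsol σ b fun a => ∑ c, MvPolynomial.C (V a c) * MvPolynomial.X c
    refine ⟨z, ?_⟩
    have : Z.mulVec z + U.mulVec (x • z + G.mulVec z) = V.mulVec z := by
      simp [V, Matrix.add_mulVec, Matrix.mulVec_add, Matrix.mulVec_smul, Matrix.smul_mulVec,
        add_assoc]
    rw [this]
    ext a
    simpa [Matrix.mulVec, dotProduct] using hz a
  -- A walk either never goes below its starting level or makes a first passage to the level below.
  let H : ℕ → σ → A := fun n => Nat.rec 0 (fun q v => x ^ q • E + G.mulVec v) n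
  have hH (q : ℕ) : H (q + 1) = x ^ q • E + G.mulVec (H q) := rfl
  refine ⟨H, rfl, fun q => ?_⟩
  have h1 (v : σ → A) : G.mulVec v = τ • (D.mulVec v + Z.mulVec (G.mulVec v) +
      U.mulVec (G.mulVec (G.mulVec v))) := by
    conv_lhs => rw [hG]
    simp [Matrix.smul_mulVec, Matrix.add_mulVec, Matrix.mulVec_mulVec, Matrix.mul_assoc]
  rw [hH (q + 1), hH q]
  conv_lhs => rw [h1, hE]
  simp only [Matrix.mulVec_add, Matrix.mulVec_smul, smul_add, smul_smul, pow_succ]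
  rw [mul_comm τ (x ^ q), show τ * (x ^ q * x) = x ^ q * (τ * x) by ring]
  simp only [mul_smul]
  abel

/-! ### Algebraicity of the Laurent coefficients -/

theorem isAlgebraic_C_halfLaurent {K : Type*} [Field K] {e : ℕ} (r : HalfLaurent K e) :
    IsAlgebraic (polyXYT K e) (PowerSeries.C r) := by
  have hB (a : (HalfLaurent K e)⟦X⟧) (ha : a ∈ polyXYT K e) : IsAlgebraic (polyXYT K e) a :=
    isAlgebraic_algebraMap (⟨a, ha⟩ : polyXYT K e)
  let T : AddSubmonoid (ℕ × (Fin e → ℤ)) :=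
    { carrier := {g | IsAlgebraic (polyXYT K e)
        (PowerSeries.C (AddMonoidAlgebra.single g (1 : K)))}
      zero_mem' := hB _ (one_mem (polyXYT K e))
      add_mem' := fun {a b} ha hb => by
        have := IsAlgebraic.mul ha hb
        rwa [← map_mul, AddMonoidAlgebra.single_mul_single, one_mul] at this }
  have hx : ((1 : ℕ), (0 : Fin e → ℤ)) ∈ T :=
    hB _ (Algebra.subset_adjoin (Or.inl (Or.inl rfl)))
  have hyB (l : Fin e) : PowerSeries.C
      (AddMonoidAlgebra.single ((0 : ℕ), (Pi.single l 1 : Fin e → ℤ)) (1 : K)) ∈ polyXYT K e :=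
    Algebra.subset_adjoin (Or.inr ⟨l, rfl⟩)
  have hy (l : Fin e) : ((0 : ℕ), (Pi.single l 1 : Fin e → ℤ)) ∈ T := hB _ (hyB l)
  have hy' (l : Fin e) : ((0 : ℕ), (Pi.single l (-1) : Fin e → ℤ)) ∈ T := by
    -- The inverse of `y_l` is a root of `y_l X - 1`.
    refine ⟨Polynomial.C ⟨_, hyB l⟩ * Polynomial.X - 1, fun h => ?_, ?_⟩
    · have := congrArg (Polynomial.coeff · 0) h
      simp at this
    · simp only [map_sub, map_mul, Polynomial.aeval_C, Polynomial.aeval_X, map_one]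
      change PowerSeries.C _ * PowerSeries.C _ - 1 = 0
      rw [← map_mul, AddMonoidAlgebra.single_mul_single, Prod.mk_add_mk, ← Pi.single_add]
      simp [← AddMonoidAlgebra.one_def, ← Prod.zero_eq_mk]
  have hz (l : Fin e) (z : ℤ) : ((0 : ℕ), (Pi.single l z : Fin e → ℤ)) ∈ T := by
    obtain ⟨n, rfl | rfl⟩ := z.eq_nat_or_neg
    · have := T.nsmul_mem (hy l) n
      simpa [← Pi.single_smul] using this
    · have := T.nsmul_mem (hy' l) n
      simpa [← Pi.single_smul] using this
  have hT (g : ℕ × (Fin e → ℤ)) : g ∈ T := by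
    have h1 : g = g.1 • ((1 : ℕ), (0 : Fin e → ℤ)) +
        ∑ l, ((0 : ℕ), (Pi.single l (g.2 l) : Fin e → ℤ)) := by
      refine Prod.ext ?_ ?_
      · simp [Prod.fst_sum]
      · simp [Prod.snd_sum, Finset.univ_sum_single]
    rw [h1]
    exact T.add_mem (T.nsmul_mem hx _) (T.sum_mem fun l _ => hz l _)
  induction r using AddMonoidAlgebra.induction_on with
  | of g => exact hT g
  | add f g hf hg => rw [map_add]; exact hf.add hg
  | smul c f hf =>
    have : PowerSeries.C (c • f) = algebraMap K (HalfLaurent K e)⟦X⟧ c * PowerSeries.C f := by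
      rw [Algebra.smul_def, map_mul, PowerSeries.algebraMap_apply]
    rw [this]
    exact (hB _ ((polyXYT K e).algebraMap_mem c)).mul hf

/-! ### Reduction of a model to finitely many states -/

namespace HalfSpaceModel

variable {K : Type*} {e : ℕ}

theorem residue_congr (M : HalfSpaceModel K e) {N : ℕ} (hN : ∀ q, M.m q ∣ N)
    {P P' : ℤ × (Fin e → ℤ)} {n n' : ℕ} (h1 : (P.1 : ZMod N) = P'.1)
    (h2 : ∀ l, (P.2 l : ZMod N) = P'.2 l) (h3 : (n : ZMod N) = n') :
    M.residue P n = M.residue P' n' := by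
  funext q
  have hcast {a b : ℤ} (h : (a : ZMod N) = b) : (a : ZMod (M.m q)) = b := by
    rw [ZMod.intCast_eq_intCast_iff] at h ⊢
    exact h.of_dvd (Int.natCast_dvd_natCast.2 (hN q))
  simp only [residue]
  change Int.castRingHom (ZMod (M.m q)) _ = Int.castRingHom (ZMod (M.m q)) _
  rw [MvPolynomial.eval, MvPolynomial.eval,
    MvPolynomial.coe_eval₂Hom, MvPolynomial.coe_eval₂Hom, MvPolynomial.eval₂_comp_left,
    MvPolynomial.eval₂_comp_left]
  congr 1
  funext v
  cases v with
  | i => exact hcast h1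
  | j l => exact hcast (h2 l)
  | n => exact hcast (by simpa using h3)

/-- A positive common multiple of the moduli that bounds the first coordinates of the steps. -/
theorem exists_period (M : HalfSpaceModel K e) :
    ∃ N : ℕ, 0 < N ∧ (∀ q, M.m q ∣ N) ∧ ∀ r, ∀ s ∈ M.S r, -(N : ℤ) ≤ s.1 ∧ s.1 ≤ N := by
  -- The product gives divisibility, the sum bounds every step, and `+ 1` keeps the number positive.
  refine ⟨(∏ q, M.m q) * (∑ r, ∑ s ∈ M.S r, s.1.natAbs + 1), ?_, ?_, ?_⟩
  · exact Nat.mul_pos (Finset.prod_pos fun q _ => M.m_pos q) (Nat.succ_pos _)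
  · exact fun q => (Finset.dvd_prod_of_mem _ (Finset.mem_univ q)).mul_right _
  · intro r s hs
    have h1 : s.1.natAbs ≤ ∑ s ∈ M.S r, s.1.natAbs :=
      Finset.single_le_sum (f := fun s : ℤ × (Fin e → ℤ) => s.1.natAbs) (fun _ _ => Nat.zero_le _) hs
    have h2 : ∑ s ∈ M.S r, s.1.natAbs ≤ ∑ r, ∑ s ∈ M.S r, s.1.natAbs :=
      Finset.single_le_sum (f := fun r => ∑ s ∈ M.S r, s.1.natAbs) (fun _ _ => Nat.zero_le _)
        (Finset.mem_univ r)
    have h3 := Nat.le_mul_of_pos_left (∑ r, ∑ s ∈ M.S r, s.1.natAbs + 1)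
      (Finset.prod_pos fun q (_ : q ∈ Finset.univ) => M.m_pos q)
    omega

variable [Field K]

/-- The generating functions `g P n` of the walks that start at the point `P` at time `n` satisfy
the first-step recursion and are algebraic. -/
theorem exists_firstStep_recursion (M : HalfSpaceModel K e) :
    ∃ g : ℤ × (Fin e → ℤ) → ℕ → (HalfLaurent K e)⟦X⟧,
      (∀ P n, IsAlgebraic (polyXYT K e) (g P n)) ∧
      ∀ P n, 0 ≤ P.1 → g P n = PowerSeries.C (AddMonoidAlgebra.single (P.1.toNat, 0) 1) +
        PowerSeries.X * ∑ s ∈ M.S (M.residue P n), if 0 ≤ P.1 + s.1 then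
          PowerSeries.C (AddMonoidAlgebra.single (0, s.2) (M.w (M.residue P n) s)) *
            g (P + s) (n + 1) else 0 := by
  obtain ⟨N, hN0, hNm, hNs⟩ := M.exists_period
  have : NeZero N := ⟨hN0.ne'⟩
  obtain ⟨A, hA⟩ : ∃ A : Subalgebra (polyXYT K e) (HalfLaurent K e)⟦X⟧,
      ∀ a, a ∈ A ↔ IsAlgebraic (polyXYT K e) a :=
    ⟨Subalgebra.algebraicClosure (polyXYT K e) (HalfLaurent K e)⟦X⟧, fun _ => Iff.rfl⟩
  let τ : A := ⟨PowerSeries.X, (hA _).2 (isAlgebraic_algebraMap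
    (⟨_, Algebra.subset_adjoin (Or.inl (Or.inr rfl))⟩ : polyXYT K e))⟩
  have hsol (ι : Type) [Fintype ι] := exists_algebraic_solution (ι := ι) A hA τ rfl
  let κ (r : HalfLaurent K e) : A := ⟨PowerSeries.C r, (hA _).2 (isAlgebraic_C_halfLaurent r)⟩
  have hκmul (r r' : HalfLaurent K e) : κ (r * r') = κ r * κ r' := Subtype.ext (map_mul _ r r')
  have hκpow (r : HalfLaurent K e) (q : ℕ) : κ (r ^ q) = κ r ^ q := Subtype.ext (map_pow _ r q)
  let σ := ZMod N × (Fin e → ZMod N) × ZMod N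
  let st (P : ℤ × (Fin e → ℤ)) (n : ℕ) : σ := (P.1, fun l => P.2 l, n)
  let res (a : σ) : ∀ q, ZMod (M.m q) :=
    M.residue ((a.1.val : ℤ), fun l => ((a.2.1 l).val : ℤ)) a.2.2.val
  have hres (P n) : res (st P n) = M.residue P n :=
    M.residue_congr hNm (by simp [st]) (by simp [st]) (by simp [st])
  let nxt (a : σ) (s : ℤ × (Fin e → ℤ)) : σ :=
    (a.1 + s.1, fun l => a.2.1 l + s.2 l, a.2.2 + 1)
  have hnxt (P n s) : nxt (st P n) s = st (P + s) (n + 1) := by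
    simp [nxt, st]
  -- The level of `P` is `P.1 / N`. The change of level depends only on the residue of `P.1` and the
  -- step.
  let dir (a : σ) (s : ℤ × (Fin e → ℤ)) : ℤ := (a.1.val + s.1) / N
  have hdir (P n s) : (P + s).1 / N = P.1 / N + dir (st P n) s := by
    simp only [dir, st, ZMod.val_intCast, Prod.fst_add]
    have := Int.emod_add_mul_ediv P.1 N
    conv_lhs => rw [← this, add_right_comm, Int.add_mul_ediv_left _ _ (by omega)]
    ring
  let T (δ : ℤ) : Matrix σ σ A := Matrix.of fun a c => ∑ s ∈ M.S (res a),
    if nxt a s = c ∧ dir a s = δ then κ (AddMonoidAlgebra.single (0, s.2) (M.w (res a) s)) else 0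
  have hT (δ : ℤ) (v : σ → A) (a : σ) : (T δ).mulVec v a = ∑ s ∈ M.S (res a),
      if dir a s = δ then
        κ (AddMonoidAlgebra.single (0, s.2) (M.w (res a) s)) * v (nxt a s) else 0 := by
    simp only [Matrix.mulVec, dotProduct, T, Matrix.of_apply, Finset.sum_mul]
    rw [Finset.sum_comm]
    refine Finset.sum_congr rfl fun s _ => ?_
    by_cases h : dir a s = δ <;> simp [h]
  -- The matrices record `y`-displacements, whereas `x` marks the absolute endpoint: the residue
  -- gives the exponent within a level, and each level contributes `x ^ N`.
  obtain ⟨H, hH0, hH⟩ := exists_level_recursion τ hsol (T (-1)) (T 0) (T 1)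
    (fun a => κ (AddMonoidAlgebra.single (a.1.val, 0) 1))
    (κ (AddMonoidAlgebra.single (N, 0) 1))
  -- The shift by one sends level `-1` to index `0`, where `H` vanishes.
  refine ⟨fun P n => H (P.1 / N + 1).toNat (st P n), fun P n => (hA _).1 (Subtype.prop _),
    fun P n hP => ?_⟩
  obtain ⟨q, hq⟩ := Int.eq_ofNat_of_zero_le (Int.ediv_nonneg hP (Int.natCast_nonneg N))
  have hstart : κ (AddMonoidAlgebra.single (N, 0) 1) ^ q *
      κ (AddMonoidAlgebra.single ((st P n).1.val, 0) 1) =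
      κ (AddMonoidAlgebra.single (P.1.toNat, 0) 1) := by
    rw [← hκpow, ← hκmul, AddMonoidAlgebra.single_pow, AddMonoidAlgebra.single_mul_single]
    have : q * N + (st P n).1.val = P.1.toNat := by
      have h1 := Int.emod_add_mul_ediv P.1 N
      rw [hq, ← ZMod.val_intCast] at h1
      zify
      rw [Int.toNat_of_nonneg hP, ← h1]
      simp only [st]
      ring
    simp [this]
  have hstep (s) (hs : s ∈ M.S (res (st P n))) :
      dir (st P n) s = -1 ∨ dir (st P n) s = 0 ∨ dir (st P n) s = 1 := by
    obtain ⟨h1, h2⟩ := hNs _ s hs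
    have h3 := ZMod.val_lt (st P n).1
    have h4 : dir (st P n) s < 2 := Int.ediv_lt_of_lt_mul (by omega) (by omega)
    have h5 : -1 ≤ dir (st P n) s := (Int.le_ediv_iff_mul_le (by omega)).2 (by omega)
    omega
  have hneg (s : ℤ × (Fin e → ℤ)) : 0 ≤ P.1 + s.1 ↔ 0 ≤ q + dir (st P n) s := by
    have := hdir P n s
    rw [hq, Prod.fst_add] at this
    rw [← this, Int.ediv_nonneg_iff_of_pos (by omega)]
  have key : H (P.1 / N + 1).toNat (st P n) = κ (AddMonoidAlgebra.single (P.1.toNat, 0) 1) +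
      τ * ∑ s ∈ M.S (M.residue P n), if 0 ≤ P.1 + s.1 then
        κ (AddMonoidAlgebra.single (0, s.2) (M.w (M.residue P n) s)) *
          H ((P + s).1 / N + 1).toNat (st (P + s) (n + 1)) else 0 := by
    rw [show (P.1 / N + 1).toNat = q + 1 by omega, hH]
    simp only [Pi.add_apply, Pi.smul_apply, smul_eq_mul, hstart, hT, ← Finset.sum_add_distrib]
    congr 2
    rw [← hres]
    refine Finset.sum_congr rfl fun s hs => ?_
    rw [hdir P n s, hq, hnxt]
    simp only [hneg]
    rcases hstep s hs with h | h | h <;> rw [h]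
    -- A down-step from level `0` leaves the half-space; the missing term of the sum agrees with `H
    -- 0 = 0`.
    · rcases q with _ | q
      · simp [hH0]
      · have h1 : ((q + 1 : ℕ) + (-1) + 1 : ℤ).toNat = q + 1 := by omega
        rw [h1]
        simp
    · have h1 : ((q : ℤ) + 0 + 1).toNat = q + 1 := by omega
      rw [h1]
      simp
    · have h1 : ((q : ℤ) + 1 + 1).toNat = q + 2 := by omega
      have h2 : (0 : ℤ) ≤ q + 1 := by omega
      rw [h1]
      simp [h2]
  have := congrArg (A.val) key
  simp only [map_add, map_mul, map_sum, apply_ite A.val, map_zero] at this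
  exact this

end HalfSpaceModel

/-! ### Identification of `F` with the solution of the recursion -/

namespace HalfSpaceModel

variable {K : Type*} {e : ℕ}

theorem pos_zero (M : HalfSpaceModel K e) {n : ℕ} (s : Fin n → ℤ × (Fin e → ℤ)) :
    M.pos s 0 = ((M.start.1 : ℤ), M.start.2) := by
  simp [pos]

theorem pos_snoc_of_le (M : HalfSpaceModel K e) {n l : ℕ} (s : Fin n → ℤ × (Fin e → ℤ))
    (u : ℤ × (Fin e → ℤ)) (hl : l ≤ n) :
    M.pos (Fin.snoc (α := fun _ => ℤ × (Fin e → ℤ)) s u) l = M.pos s l := by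
  simp [pos, Finset.sum_filter, Fin.sum_univ_castSucc, hl.not_gt]

theorem pos_snoc_succ (M : HalfSpaceModel K e) {n : ℕ} (s : Fin n → ℤ × (Fin e → ℤ))
    (u : ℤ × (Fin e → ℤ)) :
    M.pos (Fin.snoc (α := fun _ => ℤ × (Fin e → ℤ)) s u) (n + 1) = M.pos s n + u := by
  simp [pos, Finset.sum_filter, Fin.sum_univ_castSucc, add_assoc]

theorem isWalk_snoc (M : HalfSpaceModel K e) {n : ℕ} (s : Fin n → ℤ × (Fin e → ℤ))
    (u : ℤ × (Fin e → ℤ)) :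
    M.IsWalk (Fin.snoc (α := fun _ => ℤ × (Fin e → ℤ)) s u) ↔
      M.IsWalk s ∧ u ∈ M.S (M.residue (M.pos s n) n) ∧ 0 ≤ (M.pos s n).1 + u.1 := by
  have h1 : (∀ l ≤ n + 1, 0 ≤ (M.pos (Fin.snoc (α := fun _ => ℤ × (Fin e → ℤ)) s u) l).1) ↔
      (∀ l ≤ n, 0 ≤ (M.pos s l).1) ∧ 0 ≤ (M.pos s n).1 + u.1 := by
    constructor
    · intro h
      refine ⟨fun l hl => ?_, ?_⟩
      · rw [← pos_snoc_of_le M s u hl]; exact h l (by omega)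
      · have := h (n + 1) le_rfl
        rwa [pos_snoc_succ] at this
    · rintro ⟨h, h'⟩ l hl
      rcases Nat.le_succ_iff.1 hl with hl | rfl
      · rw [pos_snoc_of_le M s u hl]; exact h l hl
      · rw [pos_snoc_succ]; exact h'
  have h2 (a : Fin n) := pos_snoc_of_le M s u a.2.le
  simp only [IsWalk, h1, Fin.forall_fin_succ', Fin.snoc_castSucc, Fin.snoc_last,
    Fin.val_castSucc, Fin.val_last, h2, pos_snoc_of_le M s u le_rfl]
  tauto

theorem sum_walks_succ {B : Type*} [AddCommMonoid B] (M : HalfSpaceModel K e) (n : ℕ)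
    (φ : (Fin (n + 1) → ℤ × (Fin e → ℤ)) → B) :
    ∑ s ∈ M.walks (n + 1), φ s = ∑ s ∈ M.walks n, ∑ u ∈ M.S (M.residue (M.pos s n) n),
      if 0 ≤ (M.pos s n).1 + u.1 then φ (Fin.snoc (α := fun _ => ℤ × (Fin e → ℤ)) s u)
      else 0 := by
  simp only [← Finset.sum_filter]
  rw [Finset.sum_sigma']
  refine Finset.sum_bij' (fun s _ => ⟨Fin.init s, s (Fin.last n)⟩)
    (fun p _ => Fin.snoc (α := fun _ => ℤ × (Fin e → ℤ)) p.1 p.2) ?_ ?_ ?_ ?_ ?_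
  · intro s hs
    rw [mem_walks, ← Fin.snoc_init_self s, isWalk_snoc] at hs
    simpa [mem_walks] using hs
  · intro p hp
    simpa [mem_walks, isWalk_snoc] using hp
  · intro s _
    exact Fin.snoc_init_self s
  · intro p _
    simp
  · intro s _
    rw [Fin.snoc_init_self]

variable [Field K]

theorem weight_snoc (M : HalfSpaceModel K e) {n : ℕ} (s : Fin n → ℤ × (Fin e → ℤ))
    (u : ℤ × (Fin e → ℤ)) :
    M.weight (Fin.snoc (α := fun _ => ℤ × (Fin e → ℤ)) s u) =
      M.weight s * M.w (M.residue (M.pos s n) n) u := by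
  have h2 (a : Fin n) := pos_snoc_of_le M s u a.2.le
  simp only [weight, Fin.prod_univ_castSucc, Fin.snoc_castSucc, Fin.snoc_last,
    Fin.val_castSucc, Fin.val_last, h2, pos_snoc_of_le M s u le_rfl]

theorem coeff_F_eq_sum (M : HalfSpaceModel K e) (n : ℕ) :
    PowerSeries.coeff n M.F = ∑ s ∈ M.walks n,
      AddMonoidAlgebra.single ((M.pos s n).1.toNat, (M.pos s n).2) (M.weight s) := by
  classical
  ext P
  obtain ⟨i, j⟩ := P
  rw [coeff_F]
  simp only [f, Finset.sum_filter, AddMonoidAlgebra.coeff_sum, Finsupp.finsetSum_apply,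
    AddMonoidAlgebra.coeff_single, Finsupp.single_apply]
  refine Finset.sum_congr rfl fun s hs => ?_
  have h := ((M.mem_walks s).1 hs).1 n le_rfl
  congr 1
  simp only [Prod.ext_iff, eq_iff_iff]
  refine and_congr_left fun _ => ?_
  omega

theorem C_single_mul_C_single (i : ℕ) (a b : Fin e → ℤ) (c d : K) :
    (PowerSeries.C (AddMonoidAlgebra.single (0, a) c : HalfLaurent K e)) *
      PowerSeries.C (AddMonoidAlgebra.single (i, b) d : HalfLaurent K e) =
      PowerSeries.C (AddMonoidAlgebra.single (i, a + b) (c * d)) := by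
  rw [← map_mul, AddMonoidAlgebra.single_mul_single, Prod.mk_add_mk, zero_add]

/-- Multiplying by `y ^ P.2` turns the relative displacements recorded by `g` into absolute
positions. -/
theorem firstStep_single_mul (M : HalfSpaceModel K e)
    (g : ℤ × (Fin e → ℤ) → ℕ → (HalfLaurent K e)⟦X⟧)
    (hg : ∀ P n, 0 ≤ P.1 → g P n = PowerSeries.C (AddMonoidAlgebra.single (P.1.toNat, 0) 1) +
        PowerSeries.X * ∑ s ∈ M.S (M.residue P n), if 0 ≤ P.1 + s.1 then
          PowerSeries.C (AddMonoidAlgebra.single (0, s.2) (M.w (M.residue P n) s)) *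
            g (P + s) (n + 1) else 0)
    (P : ℤ × (Fin e → ℤ)) (n : ℕ) (hP : 0 ≤ P.1) (c : K) :
    PowerSeries.C (AddMonoidAlgebra.single (0, P.2) c) * g P n =
      PowerSeries.C (AddMonoidAlgebra.single (P.1.toNat, P.2) c) +
        PowerSeries.X * ∑ s ∈ M.S (M.residue P n), if 0 ≤ P.1 + s.1 then
          PowerSeries.C (AddMonoidAlgebra.single (0, (P + s).2) (c * M.w (M.residue P n) s)) *
            g (P + s) (n + 1) else 0 := by
  rw [hg P n hP, mul_add, C_single_mul_C_single, add_zero, mul_one, mul_left_comm, Finset.mul_sum]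
  congr 2
  refine Finset.sum_congr rfl fun s _ => ?_
  rw [mul_ite, mul_zero, ← mul_assoc, C_single_mul_C_single, Prod.snd_add]

/-- Unrolling the recursion `n` times: walks shorter than `n` contribute the first coefficients of
`F`, and walks of length `n` carry the generating function of their continuations. -/
theorem firstStep_expansion (M : HalfSpaceModel K e)
    (g : ℤ × (Fin e → ℤ) → ℕ → (HalfLaurent K e)⟦X⟧)
    (hg : ∀ P n, 0 ≤ P.1 → g P n = PowerSeries.C (AddMonoidAlgebra.single (P.1.toNat, 0) 1) +
        PowerSeries.X * ∑ s ∈ M.S (M.residue P n), if 0 ≤ P.1 + s.1 then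
          PowerSeries.C (AddMonoidAlgebra.single (0, s.2) (M.w (M.residue P n) s)) *
            g (P + s) (n + 1) else 0) (n : ℕ) :
    PowerSeries.C (AddMonoidAlgebra.single (0, M.start.2) 1) * g (M.start.1, M.start.2) 0 =
      ∑ l ∈ Finset.range n, PowerSeries.C (PowerSeries.coeff l M.F) * PowerSeries.X ^ l +
        PowerSeries.X ^ n * ∑ s ∈ M.walks n,
          PowerSeries.C (AddMonoidAlgebra.single (0, (M.pos s n).2) (M.weight s)) *
            g (M.pos s n) n := by
  induction n with
  | zero =>
    have h0 (s : Fin 0 → ℤ × (Fin e → ℤ)) : s ∈ M.walks 0 := by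
      rw [mem_walks]
      refine ⟨fun l hl => ?_, fun a => a.elim0⟩
      rw [Nat.le_zero.1 hl, pos_zero]
      exact Int.natCast_nonneg _
    have h1 : M.walks 0 = {Fin.elim0} := by
      ext s
      simp [h0, Subsingleton.elim s Fin.elim0]
    simp [h1, pos_zero, weight]
  | succ n ih =>
    rw [ih, Finset.sum_range_succ, add_assoc]
    congr 1
    have h1 : ∑ s ∈ M.walks n,
          PowerSeries.C (AddMonoidAlgebra.single (0, (M.pos s n).2) (M.weight s)) *
            g (M.pos s n) n = PowerSeries.C (PowerSeries.coeff n M.F) +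
          PowerSeries.X * ∑ s ∈ M.walks (n + 1),
          PowerSeries.C (AddMonoidAlgebra.single (0, (M.pos s (n + 1)).2) (M.weight s)) *
            g (M.pos s (n + 1)) (n + 1) := by
      rw [sum_walks_succ, coeff_F_eq_sum, map_sum, Finset.mul_sum, ← Finset.sum_add_distrib]
      refine Finset.sum_congr rfl fun s hs => ?_
      rw [M.firstStep_single_mul g hg _ _ (((M.mem_walks s).1 hs).1 n le_rfl)]
      simp only [pos_snoc_succ, weight_snoc]
    rw [h1]
    ring

theorem F_eq_of_firstStep (M : HalfSpaceModel K e)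
    (g : ℤ × (Fin e → ℤ) → ℕ → (HalfLaurent K e)⟦X⟧)
    (hg : ∀ P n, 0 ≤ P.1 → g P n = PowerSeries.C (AddMonoidAlgebra.single (P.1.toNat, 0) 1) +
        PowerSeries.X * ∑ s ∈ M.S (M.residue P n), if 0 ≤ P.1 + s.1 then
          PowerSeries.C (AddMonoidAlgebra.single (0, s.2) (M.w (M.residue P n) s)) *
            g (P + s) (n + 1) else 0) :
    M.F = PowerSeries.C (AddMonoidAlgebra.single (0, M.start.2) 1) *
      g (M.start.1, M.start.2) 0 := by
  ext1 n
  -- Expanding to order `n + 1` makes the remainder invisible to coefficient `n`.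
  rw [M.firstStep_expansion g hg (n + 1), map_add, PowerSeries.coeff_X_pow_mul', if_neg (by omega)]
  simp [PowerSeries.coeff_C_mul, PowerSeries.coeff_X_pow]

end HalfSpaceModel

theorem theorem1 {K : Type*} [Field K] [CharZero K] {e : ℕ} (M : HalfSpaceModel K e) :
    IsAlgebraic (polyXYT K e) M.F := by
  obtain ⟨g, halg, hg⟩ := M.exists_firstStep_recursion
  rw [M.F_eq_of_firstStep g hg]
  exact (isAlgebraic_C_halfLaurent _).mul (halg _ _)
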